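/- A \emph{configuration} is a finite linear triple system, i.e. a finite point set $V$ with a set of $3$-element subsets of $V$ (blocks) such that any two distinct points lie in at most one common block and every point lies in at least one block. An \emph{$s$-pattern} is a finite forest without isolated vertices, with an edge-colouring whose colour classes are matchings $M^1,\dots,M^s$ (so its edge set is the disjoint union of $M^1,\dots,M^s$), such that for every $1\le i\le s$ every edge of $M^i$ has an endpoint that is not covered by any edge of any $M^j$ with $i<j\le s$. A configuration $C$ is an \emph{$s$-configuration} if it is obtained from an $s$-pattern by replacing, for each $i$, every edge $e\in M^i$ by the triple $e\cup\{v_i\}$, where the augmenting points $v_1,\dots,v_s$ are distinct and are not vertices of the $s$-pattern. A \emph{Steiner triple system} of order $n$, STS$(n)$, is an $n$-element set of points with a set of $3$-element subsets (blocks) such that every pair of distinct points lies in exactly one block; $n$ is \emph{admissible} if $n\equiv 1$ or $3\pmod 6$. A configuration $C$ is \emph{$t$-Ramsey} if there is an $n_0=n_0(C,t)$ such that for every admissible $n\ge n_0$, in every colouring of the blocks of any STS$(n)$ with $t$ colours there is a monochromatic copy of $C$, i.e. an injective map from the points of $C$ to the points of the STS$(n)$ taking all blocks of $C$ to blocks of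 one and the same colour. \textbf{Corollary.} For all integers $s,t\ge 1$, every $s$-configuration is $t$-Ramsey. -/

import Mathlib

universe u v

/-- A configuration (partial Steiner triple system, that is, linear triple system) with point set
`V`: a finite set of `3`-element blocks such that every pair of distinct points lies in at most one
block; as is customary, every point lies in at least one block. -/
structure Configuration (V : Type u) where
  blocks : Finset (Finset V)
  card_block : ∀ B ∈ blocks, B.card = 3
  pair_unique : ∀ x y : V, x ≠ y → ∀ B ∈ blocks, ∀ B' ∈ blocks,
    x ∈ B → y ∈ B → x ∈ B' → y ∈ B' → B = B'
  covered : ∀ x : V, ∃ B ∈ blocks, x ∈ B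

/-- A Steiner triple system with point set `W`: a set of `3`-element blocks such that every pair of
distinct points lies in exactly one block. -/
structure SteinerTripleSystem (W : Type v) where
  blocks : Finset (Finset W)
  card_block : ∀ B ∈ blocks, B.card = 3
  pair_block : ∀ x y : W, x ≠ y → ∃! B : Finset W, B ∈ blocks ∧ x ∈ B ∧ y ∈ B

/-- The forest `F`, edge-coloured with colour classes `M 0, …, M (s - 1)`, is an `s`-pattern:
the colouring is proper, i.e. the edge set is the disjoint union of the matchings `M i`, and each
edge of `M i` has an endpoint that is not covered by any edge of any `M j` with `i < j`.
The vertices of the pattern are the endpoints of its edges, i.e. the elements of `F.support`;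
the other elements of the ambient type `V` play no role. -/
structure IsSPattern {V : Type u} (F : SimpleGraph V) {s : ℕ} (M : Fin s → Set (Sym2 V)) :
    Prop where
  acyclic : F.IsAcyclic
  edgeSet_eq : F.edgeSet = ⋃ i, M i
  disjoint : ∀ i j, i ≠ j → Disjoint (M i) (M j)
  matching : ∀ i, ∀ e ∈ M i, ∀ e' ∈ M i, ∀ x, x ∈ e → x ∈ e' → e = e'
  free_endpoint : ∀ i, ∀ e ∈ M i, ∃ x ∈ e, ∀ j, i < j → ∀ e' ∈ M j, x ∉ e'

/-- `C` is an `s`-configuration: there is an `s`-pattern `F`, `M` on some of the points of `C`, and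
there are distinct augmenting points `a i` (one for each colour), none of them a vertex of the
pattern, such that the blocks of `C` are exactly the triples `e ∪ {a i}` with `e ∈ M i`.
(Since the points of `C` are covered by blocks, each point of `C` is a vertex of the pattern or an
augmenting point, and each `M i` is nonempty.) -/
def Configuration.IsSConfiguration {V : Type u} (C : Configuration V) (s : ℕ) : Prop :=
  ∃ (F : SimpleGraph V) (M : Fin s → Set (Sym2 V)) (a : Fin s → V),
    IsSPattern F M ∧
    Function.Injective a ∧
    (∀ i, a i ∉ F.support) ∧
    ∀ B : Finset V, B ∈ C.blocks ↔ ∃ i, ∃ e ∈ M i, ∀ x, x ∈ B ↔ x ∈ e ∨ x = a i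

/-- In the block colouring `c` of the Steiner triple system `S` there is a monochromatic copy
of `C`: an injective map of points taking every block of `C` to a block of `S` of one
fixed colour `k`. -/
def HasMonochromaticCopy {V : Type u} (C : Configuration V) {W : Type v}
    (S : SteinerTripleSystem W) {t : ℕ} (c : {B : Finset W // B ∈ S.blocks} → Fin t) : Prop :=
  ∃ (f : V ↪ W) (k : Fin t), ∀ B ∈ C.blocks, ∃ h : B.map f ∈ S.blocks, c ⟨B.map f, h⟩ = k

/-- `C` is `t`-Ramsey: for all large enough admissible `n`, in every `t`-colouring of the blocks of
any Steiner triple system of order `n` there is a monochromatic copy of `C`. -/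
def Configuration.IsRamsey {V : Type u} (C : Configuration V) (t : ℕ) : Prop :=
  ∃ n₀ : ℕ, ∀ n : ℕ, n₀ ≤ n → (n % 6 = 1 ∨ n % 6 = 3) →
    ∀ (W : Type v) [Fintype W], Fintype.card W = n →
      ∀ (S : SteinerTripleSystem W) (c : {B : Finset W // B ∈ S.blocks} → Fin t),
        HasMonochromaticCopy C S c

/-! Pigeonholing the pairs between two halves of a large point set by third point and colour gives
many blocks of one colour through one apex. These hook trees onto trees, so iteration yields
linearly many disjoint binomial trees of order `s * t`, with one apex and one colour per label
(`exists_isBinomialFamily`). Some colour serves `s` labels; the edges with those labels contain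
disjoint binomial trees of order `s`. Every `s`-pattern embeds in such trees
(`IsSPattern.exists_embedding`): adding colours from the last to the first, the free endpoint of
each new edge is still isolated and can be hung below the other endpoint. -/

/-- The triple `x, y, z` is a block of `S` with colour `k`. -/
def SteinerTripleSystem.HasColor {W : Type v} (S : SteinerTripleSystem W) {t : ℕ}
    (c : {B : Finset W // B ∈ S.blocks} → Fin t) (k : Fin t) (x y z : W) : Prop :=
  ∃ B : Finset W, (∀ p, p ∈ B ↔ p = x ∨ p = y ∨ p = z) ∧ ∃ h : B ∈ S.blocks, c ⟨B, h⟩ = k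

namespace SteinerTripleSystem

variable {W : Type v} {S : SteinerTripleSystem W} {t : ℕ}
  {c : {B : Finset W // B ∈ S.blocks} → Fin t} {k : Fin t} {x y z : W}

theorem HasColor.ne (h : S.HasColor c k x y z) : x ≠ y ∧ x ≠ z ∧ y ≠ z := by
  classical
  obtain ⟨B, hB, hS, -⟩ := h
  have h2 : ∀ p q : W, B ≠ {p, q} := fun p q h => by
    have := Finset.card_le_two (a := p) (b := q)
    rw [← h, S.card_block B hS] at this
    omega
  refine ⟨?_, ?_, ?_⟩ <;> rintro rfl
  · exact h2 x z (by ext p; simp [hB])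
  · exact h2 x y (by ext p; simp [hB]; tauto)
  · exact h2 x y (by ext p; simp [hB])

theorem HasColor.swap (h : S.HasColor c k x y z) : S.HasColor c k y x z := by
  obtain ⟨B, hB, hS⟩ := h
  exact ⟨B, fun p => by rw [hB]; tauto, hS⟩

theorem HasColor.rotate (h : S.HasColor c k x y z) : S.HasColor c k y z x := by
  obtain ⟨B, hB, hS⟩ := h
  exact ⟨B, fun p => by rw [hB]; tauto, hS⟩

theorem HasColor.third_unique {k' : Fin t} {z' : W} (h : S.HasColor c k x y z)
    (h' : S.HasColor c k' x y z') : z = z' := by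
  have hn := h.ne
  obtain ⟨B, hB, hS, -⟩ := h
  obtain ⟨B', hB', hS', -⟩ := h'
  have hBB : B = B' := (S.pair_block x y hn.1).unique
    ⟨hS, by simp [hB], by simp [hB]⟩ ⟨hS', by simp [hB'], by simp [hB']⟩
  have hz : z ∈ B' := hBB ▸ (hB z).2 (by simp)
  rcases (hB' z).1 hz with h | h | h
  · exact absurd h.symm hn.2.1
  · exact absurd h.symm hn.2.2
  · exact h

theorem exists_hasColor (S : SteinerTripleSystem W) (c : {B : Finset W // B ∈ S.blocks} → Fin t)
    (hxy : x ≠ y) : ∃ (z : W) (k : Fin t), S.HasColor c k x y z := by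
  classical
  obtain ⟨B, ⟨hS, hx, hy⟩, -⟩ := S.pair_block x y hxy
  obtain ⟨p, q, r, -, -, -, rfl⟩ := Finset.card_eq_three.1 (S.card_block B hS)
  have : ∃ z, ∀ u, u ∈ ({p, q, r} : Finset W) ↔ u = x ∨ u = y ∨ u = z := by
    simp only [Finset.mem_insert, Finset.mem_singleton] at hx hy ⊢
    rcases hx with rfl | rfl | rfl <;> rcases hy with rfl | rfl | rfl <;>
      first
      | exact absurd rfl hxy
      | exact ⟨p, fun u => by tauto⟩
      | exact ⟨q, fun u => by tauto⟩
      | exact ⟨r, fun u => by tauto⟩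
  obtain ⟨z, hz⟩ := this
  exact ⟨z, c ⟨_, hS⟩, _, hz, hS, rfl⟩

/-! ### Monochromatic matchings through one apex -/

/-- Between two sets of `h` points, some point outside a given small set `D` spans, in one colour,
a matching of at least the average size. -/
theorem exists_matching [Fintype W] (S : SteinerTripleSystem W)
    (c : {B : Finset W // B ∈ S.blocks} → Fin t) (A B D : Finset W) (hAB : Disjoint A B)
    [Nonempty W] (b : ℚ) (hb0 : 0 < b) (ht : 1 ≤ t)
    (hb : Fintype.card W * t * b ≤ A.card * (B.card - D.card)) :
    ∃ w ∉ D, ∃ (k : Fin t) (Y : Finset W) (f : W → W), Y ⊆ A ∧ b ≤ Y.card ∧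
      Set.InjOn f Y ∧ ∀ x ∈ Y, f x ∈ B ∧ S.HasColor c k x (f x) w := by
  classical
  have : Nonempty (Fin t) := ⟨⟨0, ht⟩⟩
  have hch : ∀ p ∈ A ×ˢ B, ∃ q : W × Fin t, S.HasColor c q.2 p.1 p.2 q.1 := fun p hp => by
    have hp := Finset.mem_product.1 hp
    obtain ⟨z, k, h⟩ := S.exists_hasColor c (Finset.disjoint_iff_ne.1 hAB _ hp.1 _ hp.2)
    exact ⟨(z, k), h⟩
  choose! T hT using hch
  -- A point of `A` and a third point in `D` determine the point of `B`.
  have hbad : ((A ×ˢ B).filter fun p => (T p).1 ∈ D).card ≤ A.card * D.card := by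
    rw [← Finset.card_product]
    refine Finset.card_le_card_of_injOn (fun p => (p.1, (T p).1)) ?_ ?_
    · intro p hp
      have hp := Finset.mem_filter.1 hp
      exact Finset.mem_coe.2 (Finset.mem_product.2 ⟨(Finset.mem_product.1 hp.1).1, hp.2⟩)
    · intro p hp p' hp' h
      have h1 := hT p (Finset.mem_filter.1 hp).1
      have h2 := hT p' (Finset.mem_filter.1 hp').1
      simp only [Prod.mk.injEq] at h
      rw [← h.1, ← h.2] at h2
      exact Prod.ext h.1 (h1.swap.rotate.third_unique h2.swap.rotate)
  have hsum := Finset.card_filter_add_card_filter_not (s := A ×ˢ B) (fun p => (T p).1 ∈ D)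
  rw [Finset.card_product] at hsum
  -- Pigeonhole over the pairs (third point, colour).
  obtain ⟨⟨w, k⟩, -, hw⟩ := Finset.exists_le_card_fiber_of_nsmul_le_card_of_maps_to
    (s := (A ×ˢ B).filter fun p => (T p).1 ∉ D) (t := Finset.univ) (f := T) (b := b)
    (fun _ _ => Finset.mem_univ _) Finset.univ_nonempty (by
      rw [Finset.card_univ, Fintype.card_prod, Fintype.card_fin, nsmul_eq_mul]
      have h1 : (((A ×ˢ B).filter fun p => (T p).1 ∈ D).card : ℚ) ≤ A.card * D.card := by
        exact_mod_cast hbad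
      have h2 : (((A ×ˢ B).filter fun p => (T p).1 ∈ D).card : ℚ)
          + ((A ×ˢ B).filter fun p => (T p).1 ∉ D).card = A.card * B.card := by
        exact_mod_cast hsum
      push_cast
      linarith)
  set P := ((A ×ˢ B).filter fun p => (T p).1 ∉ D).filter fun p => T p = (w, k) with hPdef
  have hP : ∀ p ∈ P, p.1 ∈ A ∧ p.2 ∈ B ∧ w ∉ D ∧ S.HasColor c k p.1 p.2 w := fun p hp => by
    simp only [hPdef, Finset.mem_filter] at hp
    have h := hT p hp.1.1
    have hp' := Finset.mem_product.1 hp.1.1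
    have hD := hp.1.2
    rw [hp.2] at h hD
    exact ⟨hp'.1, hp'.2, hD, h⟩
  have hPpos : 0 < P.card := by
    have := hb0.trans_le hw
    exact_mod_cast this
  obtain ⟨p₀, hp₀⟩ := Finset.card_pos.1 hPpos
  have hY : ∀ x ∈ P.image Prod.fst, ∃ y, (x, y) ∈ P := fun x hx => by
    obtain ⟨⟨x', y⟩, hp, rfl⟩ := Finset.mem_image.1 hx
    exact ⟨y, hp⟩
  choose! f hf using hY
  refine ⟨w, (hP p₀ hp₀).2.2.1, k, P.image Prod.fst, f, ?_, ?_, ?_, ?_⟩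
  · intro x hx
    exact (hP _ (hf x hx)).1
  · rw [Finset.card_image_of_injOn]
    · exact hw
    · intro p hp p' hp' h
      have h1 := (hP p hp).2.2.2
      have h2 := (hP p' hp').2.2.2
      rw [← h] at h2
      exact Prod.ext h (h1.swap.rotate.third_unique h2.swap.rotate)
  · intro x hx x' hx' h
    have h1 := (hP _ (hf x hx)).2.2.2
    have h2 := (hP _ (hf x' hx')).2.2.2
    simp only at h1 h2
    rw [← h] at h2
    exact h1.rotate.third_unique h2.rotate
  · intro x hx
    exact ⟨(hP _ (hf x hx)).2.1, (hP _ (hf x hx)).2.2.2⟩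

/-! ### Binomial trees -/

/-- A family, indexed by the roots `x ∈ X`, of disjoint binomial trees of order `m`.
The vertices of the tree at `x` are `g x I` for `I ⊆ {0, …, m - 1}`, and the edges of label `i`
join `g x I` and `g x (I ∪ {i})` for `i < min I`; each such edge forms with `w i` a block of
colour `col i`. -/
structure IsBinomialFamily (S : SteinerTripleSystem W)
    (c : {B : Finset W // B ∈ S.blocks} → Fin t) (m : ℕ) (X : Finset W)
    (w : ℕ → W) (col : ℕ → Fin t) (g : W → Finset ℕ → W) : Prop where
  root : ∀ x, g x ∅ = x
  injOn_apex : Set.InjOn w (Set.Iio m)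
  inj : ∀ x ∈ X, ∀ x' ∈ X, ∀ I ⊆ Finset.range m, ∀ I' ⊆ Finset.range m,
    g x I = g x' I' → x = x' ∧ I = I'
  block : ∀ x ∈ X, ∀ i < m, ∀ I ⊆ Finset.range m, (∀ j ∈ I, i < j) →
    S.HasColor c (col i) (g x I) (g x (insert i I)) (w i)

/-- The tree at `f x` is hung below the root `x`, and `m ∈ I` marks its vertices. As `m` exceeds all
old labels, the condition `i < min I` leaves only the edge between the two roots for label `m`. -/
theorem IsBinomialFamily.succ {m : ℕ} {X : Finset W} {w : ℕ → W} {col : ℕ → Fin t}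
    {g : W → Finset ℕ → W} (H : S.IsBinomialFamily c m X w col g) {A B Y : Finset W}
    (hA : A ⊆ X) (hB : B ⊆ X) (hAB : Disjoint A B) (hY : Y ⊆ A) {f : W → W} {v : W}
    (hf : Set.InjOn f Y) (hv : ∀ i < m, w i ≠ v)
    (hfB : ∀ x ∈ Y, f x ∈ B ∧ S.HasColor c k x (f x) v) :
    S.IsBinomialFamily c (m + 1) Y (Function.update w m v) (Function.update col m k)
      (fun x I => if m ∈ I then g (f x) (I.erase m) else g x I) := by
  classical
  have herase : ∀ I ⊆ Finset.range (m + 1), I.erase m ⊆ Finset.range m := fun I hI j hj => by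
    have h1 := Finset.mem_range.1 (hI (Finset.mem_of_mem_erase hj))
    have h2 := Finset.ne_of_mem_erase hj
    exact Finset.mem_range.2 (by omega)
  have hfX : ∀ x ∈ Y, f x ∈ X := fun x hx => hB (hfB x hx).1
  have hYX : ∀ x ∈ Y, x ∈ X := fun x hx => hA (hY hx)
  have hne : ∀ x ∈ Y, ∀ x' ∈ Y, f x ≠ x' := fun x hx x' hx' h =>
    Finset.disjoint_left.1 hAB (hY hx') (h ▸ (hfB x hx).1)
  refine ⟨fun x => by simp [H.root], ?_, ?_, ?_⟩
  · intro i hi j hj h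
    simp only [Set.mem_Iio, Nat.lt_succ_iff_lt_or_eq] at hi hj
    rcases hi with hi | rfl <;> rcases hj with hj | rfl
    · rw [Function.update_of_ne hi.ne, Function.update_of_ne hj.ne] at h
      exact H.injOn_apex hi hj h
    · rw [Function.update_of_ne hi.ne, Function.update_self] at h
      exact absurd h (hv i hi)
    · rw [Function.update_of_ne hj.ne, Function.update_self] at h
      exact absurd h.symm (hv j hj)
    · rfl
  · intro x hx x' hx' I hI I' hI' h
    have e := herase I hI
    have e' := herase I' hI'
    by_cases hm : m ∈ I <;> by_cases hm' : m ∈ I' <;> simp only [hm, hm', if_true, if_false] at h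
    · obtain ⟨h1, h2⟩ := H.inj _ (hfX x hx) _ (hfX x' hx') _ e _ e' h
      exact ⟨hf hx hx' h1, by rw [← Finset.insert_erase hm, h2, Finset.insert_erase hm']⟩
    · rw [Finset.erase_eq_of_notMem hm'] at e'
      exact absurd (H.inj _ (hfX x hx) _ (hYX x' hx') _ e _ e' h).1 (hne x hx x' hx')
    · rw [Finset.erase_eq_of_notMem hm] at e
      exact absurd (H.inj _ (hYX x hx) _ (hfX x' hx') _ e _ e' h).1.symm (hne x' hx' x hx)
    · rw [Finset.erase_eq_of_notMem hm] at e
      rw [Finset.erase_eq_of_notMem hm'] at e'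
      exact H.inj _ (hYX x hx) _ (hYX x' hx') _ e _ e' h
  · intro x hx i hi I hI hlt
    rcases Nat.lt_succ_iff_lt_or_eq.1 hi with hi | rfl
    · have e := herase I hI
      rw [Function.update_of_ne hi.ne, Function.update_of_ne hi.ne]
      by_cases hm : m ∈ I
      · have := H.block _ (hfX x hx) i hi _ e fun j hj => hlt j (Finset.mem_of_mem_erase hj)
        simpa [hm, Finset.erase_insert_of_ne hi.ne] using this
      · rw [Finset.erase_eq_of_notMem hm] at e
        simpa [hm, hi.ne'] using H.block _ (hYX x hx) i hi _ e hlt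
    · have hI0 : I = ∅ := Finset.eq_empty_of_forall_notMem fun j hj => by
        have h1 := hlt j hj
        have h2 := Finset.mem_range.1 (hI hj)
        omega
      subst hI0
      simpa [H.root] using (hfB x hx).2

/-- The roots stay a fixed fraction `1 / q` of all points, which is what lets the pigeonhole be
repeated for the next label. -/
theorem exists_isBinomialFamily (t m : ℕ) (ht : 1 ≤ t) :
    ∃ N q : ℕ, 1 ≤ q ∧ ∀ (W : Type v) [Fintype W], N ≤ Fintype.card W →
      ∀ (S : SteinerTripleSystem W) (c : {B : Finset W // B ∈ S.blocks} → Fin t),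
        ∃ X w col g, S.IsBinomialFamily c m X w col g ∧ Fintype.card W ≤ q * X.card := by
  classical
  induction m with
  | zero =>
    refine ⟨1, 1, le_rfl, fun W _ hW S c => ?_⟩
    obtain ⟨x₀⟩ := Fintype.card_pos_iff.1 hW
    refine ⟨Finset.univ, fun _ => x₀, fun _ => ⟨0, ht⟩, fun x _ => x,
      ⟨fun _ => rfl, fun i hi => absurd hi (by simp), ?_, fun _ _ i hi => absurd hi (by simp)⟩,
      by simp⟩
    intro x _ x' _ I hI I' hI' h
    simp only [Finset.range_zero, Finset.subset_empty] at hI hI'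
    exact ⟨h, hI.trans hI'.symm⟩
  | succ m ih =>
    obtain ⟨N, q, hq, hN⟩ := ih
    -- With `n` points, the first bound makes half the roots, less `m` used apexes, at least `n / (4
    -- * q)`; then `(n / (4 * q)) ^ 2 / (n * t)` is the average matching size.
    refine ⟨N + q * (4 * m + 2), 16 * q ^ 2 * t, Nat.one_le_iff_ne_zero.2 (by positivity),
      fun W _ hW S c => ?_⟩
    have hn0 : 0 < Fintype.card W := by
      have : 0 < q * (4 * m + 2) := by positivity
      omega
    have : Nonempty W := Fintype.card_pos_iff.1 hn0
    obtain ⟨X, w, col, g, hG, hX⟩ := hN W (by omega) S c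
    obtain ⟨A, hA, hAc⟩ := Finset.exists_subset_card_eq (s := X) (n := X.card / 2) (by omega)
    have hXA : X.card / 2 ≤ (X \ A).card := by
      rw [Finset.card_sdiff_of_subset hA]
      omega
    obtain ⟨B, hB, hBc⟩ := Finset.exists_subset_card_eq hXA
    have hAB : Disjoint A B := Finset.disjoint_of_subset_right hB Finset.disjoint_sdiff
    set D := (Finset.range m).image w with hD
    have hDc : (D.card : ℚ) ≤ m := by
      exact_mod_cast Finset.card_image_le.trans (Finset.card_range m).le
    have hqQ : (0 : ℚ) < q := by exact_mod_cast hq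
    have htQ : (0 : ℚ) < t := by exact_mod_cast ht
    have hnQ : (0 : ℚ) < Fintype.card W := by exact_mod_cast hn0
    have hWQ : (q : ℚ) * (4 * m + 2) ≤ Fintype.card W := by
      exact_mod_cast (Nat.le_add_left _ _).trans hW
    have hXQ : (Fintype.card W : ℚ) ≤ q * (2 * (X.card / 2 : ℕ) + 1) := by
      have h1 : X.card ≤ 2 * (X.card / 2) + 1 := by omega
      exact_mod_cast hX.trans (Nat.mul_le_mul_left q h1)
    have h1 : (Fintype.card W : ℚ) / (4 * q) ≤ (X.card / 2 : ℕ) - m := by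
      rw [div_le_iff₀ (by positivity)]
      nlinarith
    have h2 : (Fintype.card W : ℚ) / (4 * q) ≤ (X.card / 2 : ℕ) - D.card := by linarith
    have h3 : (Fintype.card W : ℚ) / (4 * q) ≤ (X.card / 2 : ℕ) := by
      have : (0 : ℚ) ≤ m := Nat.cast_nonneg m
      linarith
    obtain ⟨v, hv, k, Y, f, hYA, hYc, hf, hfB⟩ := S.exists_matching c A B D hAB
      ((Fintype.card W : ℚ) / (16 * q ^ 2 * t)) (by positivity) ht (by
        rw [hAc, hBc]
        calc (Fintype.card W : ℚ) * t * (Fintype.card W / (16 * q ^ 2 * t))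
            = Fintype.card W / (4 * q) * (Fintype.card W / (4 * q)) := by field_simp; norm_num
          _ ≤ _ := mul_le_mul h3 h2 (by positivity) (by positivity))
    refine ⟨Y, _, _, _, hG.succ hA (hB.trans Finset.sdiff_subset) hAB hYA hf
      (fun i hi h => hv (Finset.mem_image.2 ⟨i, Finset.mem_range.2 hi, h⟩)) hfB, ?_⟩
    rw [div_le_iff₀ (by positivity)] at hYc
    have : (Fintype.card W : ℚ) ≤ (16 * q ^ 2 * t) * Y.card := by linarith
    exact_mod_cast this

end SteinerTripleSystem

/-! ### Embedding patterns in binomial trees -/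

/-- An `s`-pattern embeds, with its labels, in a disjoint union of binomial trees. -/
theorem IsSPattern.exists_embedding {V : Type u} {F : SimpleGraph V} {s : ℕ}
    {M : Fin s → Set (Sym2 V)} (H : IsSPattern F M) :
    ∃ (ρ : V → V) (σ : V → Finset (Fin s)),
      (∀ x y, ρ x = ρ y → σ x = σ y → x = y) ∧
      ∀ i, ∀ e ∈ M i, ∃ x y, e = s(x, y) ∧ ρ y = ρ x ∧ σ y = insert i (σ x) ∧
        ∀ j ∈ σ x, i < j := by
  classical
  -- Labels are treated downwards: only those at least `j` are placed so far. `ρ` names the tree and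
  -- `σ` the vertex in it.
  suffices h : ∀ d j : ℕ, j + d = s → ∃ (ρ : V → V) (σ : V → Finset (Fin s)),
      (∀ x y, ρ x = ρ y → σ x = σ y → x = y) ∧ (∀ x, ∀ i ∈ σ x, j ≤ (i : ℕ)) ∧
      ∀ i : Fin s, j ≤ (i : ℕ) → ∀ e ∈ M i, ∃ x y, e = s(x, y) ∧ ρ y = ρ x ∧
        σ y = insert i (σ x) ∧ ∀ l ∈ σ x, i < l by
    obtain ⟨ρ, σ, hinj, -, h⟩ := h s 0 (by simp)
    exact ⟨ρ, σ, hinj, fun i => h i (Nat.zero_le _)⟩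
  intro d
  induction d with
  | zero =>
    intro j hj
    exact ⟨id, fun _ => ∅, fun x y h _ => h, by simp, fun i hi => absurd i.2 (by omega)⟩
  | succ d ih =>
    intro j hj
    obtain ⟨ρ, σ, hinj, hge, hedge⟩ := ih (j + 1) (by omega)
    let J : Fin s := ⟨j, by omega⟩
    -- one free endpoint of every edge of label `j` is chosen as a child
    have hch : ∀ e, ∃ p : V × V, e ∈ M J → e = s(p.1, p.2) ∧
        ∀ l, J < l → ∀ e' ∈ M l, p.2 ∉ e' := fun e => by
      by_cases he : e ∈ M J
      · obtain ⟨y, hy, hfree⟩ := H.free_endpoint J e he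
        obtain ⟨x, rfl⟩ := Sym2.mem_iff_exists.1 hy
        exact ⟨(x, y), fun _ => ⟨Sym2.eq_swap, hfree⟩⟩
      · exact ⟨Quot.out e, fun h => absurd h he⟩
    choose p hp using hch
    have hpe := fun e he => (hp e he).1
    have hpf := fun e he => (hp e he).2
    have hpne : ∀ e ∈ M J, (p e).1 ≠ (p e).2 := fun e he h => by
      have : e ∈ F.edgeSet := H.edgeSet_eq ▸ Set.mem_iUnion.2 ⟨J, he⟩
      rw [hpe e he, SimpleGraph.mem_edgeSet] at this
      exact this.ne h
    have hmem1 : ∀ e ∈ M J, (p e).1 ∈ e := fun e he => by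
      have := Sym2.mem_mk_left (p e).1 (p e).2
      rwa [← hpe e he] at this
    have hmem2 : ∀ e ∈ M J, (p e).2 ∈ e := fun e he => by
      have := Sym2.mem_mk_right (p e).1 (p e).2
      rwa [← hpe e he] at this
    have hnot : ∀ e ∈ M J, ∀ e' ∈ M J, (p e).1 ≠ (p e').2 := fun e he e' he' h => by
      obtain rfl := H.matching J e he e' he' _ (hmem1 e he) (h ▸ hmem2 e' he')
      exact hpne e he h
    have hinj2 : ∀ e ∈ M J, ∀ e' ∈ M J, (p e).2 = (p e').2 → e = e' := fun e he e' he' h =>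
      H.matching J e he e' he' _ (hmem2 e he) (h ▸ hmem2 e' he')
    -- the parent of a child, and `x` itself otherwise
    have hpar : ∃ π : V → V, ∀ e ∈ M J, π (p e).2 = (p e).1 := by
      refine ⟨fun x => if h : ∃ e ∈ M J, x = (p e).2 then (p h.choose).1 else x, fun e he => ?_⟩
      have h : ∃ e' ∈ M J, (p e).2 = (p e').2 := ⟨e, he, rfl⟩
      have hs := h.choose_spec
      have := hinj2 e he _ hs.1 hs.2
      simp only [dif_pos h]
      rw [← this]
    obtain ⟨π, hπ⟩ := hpar
    let child : V → Prop := fun x => ∃ e ∈ M J, x = (p e).2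
    let ρ' : V → V := fun x => if child x then ρ (π x) else ρ x
    let σ' : V → Finset (Fin s) := fun x => if child x then insert J (σ (π x)) else σ x
    -- Old addresses avoid `J`, so moved vertices cannot collide with unmoved ones.
    have hJ : ∀ x, J ∉ σ x := fun x h => by
      have := hge x J h
      simp only [J] at this
      omega
    refine ⟨ρ', σ', ?_, ?_, ?_⟩
    · intro x y h1 h2
      by_cases hx : child x <;> by_cases hy : child y <;>
        simp only [ρ', σ', hx, hy, if_true, if_false] at h1 h2
      · have h3 : σ (π x) = σ (π y) := by
          rw [← Finset.erase_insert (hJ (π x)), h2, Finset.erase_insert (hJ (π y))]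
        have h4 := hinj _ _ h1 h3
        obtain ⟨e, he, rfl⟩ := hx
        obtain ⟨e', he', rfl⟩ := hy
        rw [hπ e he, hπ e' he'] at h4
        rw [H.matching J e he e' he' _ (hmem1 e he) (h4 ▸ hmem1 e' he')]
      · exact absurd (h2 ▸ Finset.mem_insert_self _ _) (hJ y)
      · exact absurd (h2 ▸ Finset.mem_insert_self _ _) (hJ x)
      · exact hinj _ _ h1 h2
    · intro x i hi
      by_cases hx : child x <;> simp only [σ', hx, if_true, if_false] at hi
      · rcases Finset.mem_insert.1 hi with rfl | hi
        · exact le_rfl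
        · exact (Nat.le_succ j).trans (hge _ i hi)
      · exact (Nat.le_succ j).trans (hge _ i hi)
    · intro i hi e he
      rcases hi.eq_or_lt with hij | hij
      · obtain rfl : J = i := Fin.ext hij
        have hc1 : ¬ child (p e).1 := fun ⟨e', he', h⟩ => hnot e he e' he' h
        have hc2 : child (p e).2 := ⟨e, he, rfl⟩
        refine ⟨(p e).1, (p e).2, hpe e he, ?_, ?_, ?_⟩
        · simp only [ρ', hc1, hc2, if_true, if_false, hπ e he]
        · simp only [σ', hc1, hc2, if_true, if_false, hπ e he]
        · simp only [σ', hc1, if_false]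
          exact fun l hl => hge _ l hl
      · obtain ⟨x, y, rfl, h1, h2, h3⟩ := hedge i hij e he
        -- Children are free of later labels, so edges already placed do not move.
        have hc : ∀ z ∈ s(x, y), ¬ child z := fun z hz ⟨e', he', h⟩ =>
          hpf e' he' i hij _ he (h ▸ hz)
        have hx := hc x (Sym2.mem_mk_left _ _)
        have hy := hc y (Sym2.mem_mk_right _ _)
        exact ⟨x, y, rfl, by simp only [ρ', hx, hy, if_false, h1],
          by simp only [σ', hx, hy, if_false, h2], by simpa only [σ', hx, if_false] using h3⟩

/-! ### Assembling the monochromatic copy -/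

theorem mainTheorem5 {V : Type u} [Finite V] (C : Configuration V) (s t : ℕ)
    (hs : 1 ≤ s) (ht : 1 ≤ t) (hC : C.IsSConfiguration s) :
    Configuration.IsRamsey.{u, v} C t := by
  classical
  have := Fintype.ofFinite V
  obtain ⟨F, M, a, hP, ha, haF, hblocks⟩ := hC
  obtain ⟨ρ, σ, hinj, hedge⟩ := hP.exists_embedding
  obtain ⟨N, q, hq, hN⟩ := SteinerTripleSystem.exists_isBinomialFamily.{v} t (s * t) ht
  -- At most `s * t` trees are lost to apexes; `|V|` remain, enough for all values of `ρ`.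
  refine ⟨N + q * (Fintype.card V + s * t), fun n hn _ W _ hW S c => ?_⟩
  obtain ⟨X, w, col, g, hG, hX⟩ := hN W (by omega) S c
  have hXcard : Fintype.card V + s * t ≤ X.card := by
    by_contra! h
    have := Nat.mul_lt_mul_of_pos_left h hq
    omega
  -- trees through an apex are discarded
  let Z := X.filter fun x => ∃ I ⊆ Finset.range (s * t), ∃ i < s * t, g x I = w i
  have hZ : Z.card ≤ s * t := by
    have hch : ∀ x ∈ Z, ∃ I ⊆ Finset.range (s * t), ∃ i < s * t, g x I = w i :=
      fun x hx => (Finset.mem_filter.1 hx).2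
    choose! I hI i hi hgi using hch
    rw [← Finset.card_range (s * t)]
    refine Finset.card_le_card_of_injOn i (fun x hx => Finset.mem_coe.2 (Finset.mem_range.2 (hi x hx))) ?_
    intro x hx y hy hxy
    refine (hG.inj x (Finset.mem_filter.1 hx).1 y (Finset.mem_filter.1 hy).1 _ (hI x hx) _
      (hI y hy) ?_).1
    rw [hgi x hx, hgi y hy, hxy]
  have hcard : Fintype.card V ≤ Fintype.card ↥(X \ Z) := by
    rw [Fintype.card_coe]
    have := Finset.le_card_sdiff Z X
    omega
  obtain ⟨r⟩ := Function.Embedding.nonempty_of_card_le hcard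
  have hrX : ∀ x, (r x : W) ∈ X := fun x => (Finset.mem_sdiff.1 (r x).2).1
  -- a colour used by `s` labels
  have hfib : ∃ k ∈ (Finset.univ : Finset (Fin t)),
      s ≤ ((Finset.range (s * t)).filter fun i => col i = k).card :=
    Finset.exists_le_card_fiber_of_mul_le_card_of_maps_to (fun _ _ => Finset.mem_univ _)
      ⟨⟨0, ht⟩, Finset.mem_univ _⟩ (by simp [mul_comm])
  obtain ⟨k, -, hk⟩ := hfib
  -- An increasing choice of labels preserves `i < min I`.
  let ι := Finset.orderEmbOfCardLe _ hk
  have hι : ∀ i, ι i < s * t ∧ col (ι i) = k := fun i => by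
    have := Finset.orderEmbOfCardLe_mem _ hk i
    simpa using this
  have hιr : ∀ J : Finset (Fin s), J.image ι ⊆ Finset.range (s * t) := fun J => by
    intro j hj
    obtain ⟨i, -, rfl⟩ := Finset.mem_image.1 hj
    exact Finset.mem_range.2 (hι i).1
  let G : V → W := fun x => g (r (ρ x)) ((σ x).image ι)
  have hGinj : Function.Injective G := fun x y hxy => by
    obtain ⟨h1, h2⟩ := hG.inj _ (hrX _) _ (hrX _) _ (hιr _) _ (hιr _) hxy
    exact hinj x y (r.injective (Subtype.ext h1)) (Finset.image_injective ι.injective h2)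
  have hGw : ∀ x i, G x ≠ w (ι i) := fun x i h => by
    refine (Finset.mem_sdiff.1 (r (ρ x)).2).2 (Finset.mem_filter.2 ⟨hrX _, _, hιr _, _, (hι i).1, h⟩)
  have hwinj : ∀ i j, w (ι i) = w (ι j) → i = j := fun i j h =>
    ι.injective (hG.injOn_apex (hι i).1 (hι j).1 h)
  let f : V → W := fun x => if h : ∃ i, x = a i then w (ι h.choose) else G x
  have hfa : ∀ i, f (a i) = w (ι i) := fun i => by
    have h : ∃ j, a i = a j := ⟨i, rfl⟩
    have := ha h.choose_spec
    simp only [f, dif_pos h]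
    rw [← this]
  have hfG : ∀ x, (∀ i, x ≠ a i) → f x = G x := fun x hx => dif_neg (by simpa using hx)
  have hf : Function.Injective f := fun x y hxy => by
    by_cases hx : ∃ i, x = a i <;> by_cases hy : ∃ i, y = a i
    · obtain ⟨i, rfl⟩ := hx
      obtain ⟨j, rfl⟩ := hy
      rw [hfa, hfa] at hxy
      rw [hwinj _ _ hxy]
    · obtain ⟨i, rfl⟩ := hx
      rw [hfa, hfG y (by simpa using hy)] at hxy
      exact absurd hxy.symm (hGw _ _)
    · obtain ⟨i, rfl⟩ := hy
      rw [hfa, hfG x (by simpa using hx)] at hxy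
      exact absurd hxy (hGw _ _)
    · rw [hfG x (by simpa using hx), hfG y (by simpa using hy)] at hxy
      exact hGinj hxy
  refine ⟨⟨f, hf⟩, k, fun B hB => ?_⟩
  obtain ⟨i, e, he, hBe⟩ := (hblocks B).1 hB
  obtain ⟨x, y, rfl, hρ, hσ, hlt⟩ := hedge i e he
  have hadj : F.Adj x y := by
    rw [← SimpleGraph.mem_edgeSet, hP.edgeSet_eq]
    exact Set.mem_iUnion.2 ⟨i, he⟩
  have hx : f x = G x := hfG x fun j h => haF j (h ▸ ⟨y, hadj⟩)
  have hy : f y = G y := hfG y fun j h => haF j (h ▸ ⟨x, hadj.symm⟩)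
  have hcol := hG.block (r (ρ x)) (hrX _) (ι i) (hι i).1 ((σ x).image ι) (hιr _) (by
    simpa using hlt)
  rw [← Finset.image_insert, ← hσ, ← hρ, (hι i).2] at hcol
  obtain ⟨B', hB', hS, hc⟩ := hcol
  have hBB : B.map ⟨f, hf⟩ = B' := by
    ext p
    rw [hB']
    simp only [Finset.mem_map, Function.Embedding.coeFn_mk, hBe, Sym2.mem_iff]
    constructor
    · rintro ⟨u, (rfl | rfl) | rfl, rfl⟩
      · left; rw [hx]; simp only [G, hρ]
      · right; left; exact hy
      · right; right; exact hfa i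
    · rintro (rfl | rfl | rfl)
      · exact ⟨x, by simp, by rw [hx]; simp only [G, hρ]⟩
      · exact ⟨y, by simp, hy⟩
      · exact ⟨a i, by simp, hfa i⟩
  subst hBB
  exact ⟨hS, hc⟩
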